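/- Let $l > 5$ and $d \ge 0$ be integers, and let $S_d$ be the space of forms of degree $d$ in $\mathbb{C}[x,y,z]$. A star configuration $\mathbb{X}(l) \subset \mathbb{P}^2_{\mathbb{C}}$ is a set consisting of the $\binom{l}{2}$ pairwise intersection points of $l$ distinct lines in $\mathbb{P}^2_{\mathbb{C}}$, no three of which pass through a common point. Then the generic plane curve of degree $d$ contains no star configuration $\mathbb{X}(l)$; that is, there is a nonempty Zariski open subset $U$ (depending on $l$ and $d$) of the projective space $\mathbb{P}S_d$ of plane curves of degree $d$ such that no curve $\mathcal{C} \in U$ contains a star configuration $\mathbb{X}(l)$. -/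

import Mathlib

open scoped LinearAlgebra.Projectivization

namespace StarConfig

/-- The complex projective plane. -/
abbrev Plane : Type := ℙ ℂ (Fin 3 → ℂ)

/-- The dual projective plane: the point `(a : b : c)` stands for the line
`a x + b y + c z = 0` of `Plane`. -/
abbrev DualPlane : Type := ℙ ℂ (Fin 3 → ℂ)

/-- The set of points of the line `a x + b y + c z = 0`, where `ℓ = (a : b : c)`. -/
def linePoints (ℓ : DualPlane) : Set Plane :=
  {p | Projectivization.orthogonal ℓ p}

/-- `X` is a star configuration `𝕏(l)`: the set of pairwise intersection points of `l` distinct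
lines, no three of which pass through a common point. (As two distinct lines of the plane meet in
exactly one point, such a set consists of `l.choose 2` distinct points.) -/
def IsStarConfiguration (l : ℕ) (X : Set Plane) : Prop :=
  ∃ ℓ : Fin l → DualPlane,
    Function.Injective ℓ ∧
    (∀ i j k : Fin l, i ≠ j → i ≠ k → j ≠ k →
      linePoints (ℓ i) ∩ linePoints (ℓ j) ∩ linePoints (ℓ k) = ∅) ∧
    X = {p | ∃ i j : Fin l, i < j ∧ p ∈ linePoints (ℓ i) ∩ linePoints (ℓ j)}

/-- The space `S_d` of forms of degree `d` in three variables over `ℂ` (with zero). -/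
abbrev Form (d : ℕ) : Type := MvPolynomial.homogeneousSubmodule (Fin 3) ℂ d

/-- The projective space `ℙ S_d` of plane curves of degree `d`. -/
abbrev PlaneCurve (d : ℕ) : Type := ℙ ℂ (Form d)

/-- The set of points of a plane curve, i.e. the zero locus of any of its equations. -/
def curvePoints {d : ℕ} (C : PlaneCurve d) : Set Plane :=
  {p | MvPolynomial.eval p.rep (C.rep : MvPolynomial (Fin 3) ℂ) = 0}

/-- The exponents of the monomials of degree `d` in three variables: they index the monomial
basis of `S_d`, hence the homogeneous coordinates on `ℙ S_d`. -/
abbrev Exponent (d : ℕ) : Type := {m : Fin 3 →₀ ℕ // m.degree = d}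

/-- The coordinates of a form in the monomial basis of `S_d`. -/
def coords {d : ℕ} (F : Form d) : Exponent d → ℂ :=
  fun m => MvPolynomial.coeff m.1 (F : MvPolynomial (Fin 3) ℂ)

/-- Zariski closed subsets of `ℙ S_d`: common zero loci of sets of homogeneous polynomials
in the homogeneous coordinates. -/
def IsZariskiClosed {d : ℕ} (Z : Set (PlaneCurve d)) : Prop :=
  ∃ I : Set (MvPolynomial (Exponent d) ℂ),
    (∀ G ∈ I, ∃ n : ℕ, G.IsHomogeneous n) ∧
    Z = {C | ∀ G ∈ I, MvPolynomial.eval (coords C.rep) G = 0}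

/-- Zariski open subsets of `ℙ S_d`. -/
def IsZariskiOpen {d : ℕ} (U : Set (PlaneCurve d)) : Prop :=
  IsZariskiClosed Uᶜ

/-- The generic plane curve of degree `d` has the property `P`: all curves in some nonempty
Zariski open subset of `ℙ S_d` have it. -/
def GenericCurve (d : ℕ) (P : PlaneCurve d → Prop) : Prop :=
  ∃ U : Set (PlaneCurve d), IsZariskiOpen U ∧ U.Nonempty ∧ ∀ C ∈ U, P C

/-- A homogeneous polynomial vanishes at a nonzero multiple of a vector iff it vanishes at the
vector. -/
theorem eval_smul_eq_zero_iff {σ : Type} {G : MvPolynomial σ ℂ} {n : ℕ} (hG : G.IsHomogeneous n)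
    {a : ℂ} (ha : a ≠ 0) (v : σ → ℂ) :
    MvPolynomial.eval (a • v) G = 0 ↔ MvPolynomial.eval v G = 0 := by
  have h : MvPolynomial.eval (a • v) G = a ^ n * MvPolynomial.eval v G := by
    rw [MvPolynomial.eval_eq, MvPolynomial.eval_eq, Finset.mul_sum]
    refine Finset.sum_congr rfl fun m hm => ?_
    have hd : m.degree = n := by
      have := hG (MvPolynomial.mem_support_iff.mp hm)
      rw [Finsupp.degree_eq_weight_one]
      exact this
    simp only [Pi.smul_apply, smul_eq_mul, mul_pow, Finset.prod_mul_distrib,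
      Finset.prod_pow_eq_pow_sum]
    rw [← hd, Finsupp.degree_apply]
    ring
  rw [h]
  simp [ha]

/-- The set of points of a curve does not depend on the choice of representatives. -/
theorem mk_mem_curvePoints_iff {d : ℕ} (F : Form d) (hF : F ≠ 0) (v : Fin 3 → ℂ) (hv : v ≠ 0) :
    (Projectivization.mk ℂ v hv : Plane) ∈ curvePoints (Projectivization.mk ℂ F hF) ↔
      MvPolynomial.eval v (F : MvPolynomial (Fin 3) ℂ) = 0 := by
  obtain ⟨a, ha⟩ := Projectivization.exists_smul_eq_mk_rep ℂ v hv
  obtain ⟨b, hb⟩ := Projectivization.exists_smul_eq_mk_rep ℂ F hF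
  have hF' : (F : MvPolynomial (Fin 3) ℂ).IsHomogeneous d := F.2
  rw [curvePoints, Set.mem_ofPred_eq, ← ha, ← hb, Units.smul_def, Units.smul_def,
    Submodule.coe_smul, MvPolynomial.smul_eval,
    mul_eq_zero, eval_smul_eq_zero_iff hF' a.ne_zero]
  simp

/-- Vanishing of a homogeneous polynomial at a point of `ℙ S_d` does not depend on the choice of
a representative. -/
theorem eval_coords_mk_rep_eq_zero_iff {d n : ℕ} (F : Form d) (hF : F ≠ 0)
    {G : MvPolynomial (Exponent d) ℂ} (hG : G.IsHomogeneous n) :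
    MvPolynomial.eval (coords (Projectivization.mk ℂ F hF).rep) G = 0 ↔
      MvPolynomial.eval (coords F) G = 0 := by
  obtain ⟨b, hb⟩ := Projectivization.exists_smul_eq_mk_rep ℂ F hF
  have h : coords (b • F) = (b : ℂ) • coords F := by
    funext m
    simp [coords, Units.smul_def]
  rw [← hb, h, eval_smul_eq_zero_iff hG b.ne_zero]

end StarConfig

/-!
The proof is a dimension count. A star configuration is given by `l` lines, hence by `2 l`
parameters, and consists of `l.choose 2` points. If `d ≥ l - 2`, these points impose independent
conditions on forms of degree `d` (`InGeneralPosition.evalMatrix_surjective`): the product of all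
the lines but two vanishes at every point but one. So the forms vanishing on some star
configuration make up a family of dimension at most `dim S_d + 2 l - l.choose 2`, which is less than
`dim S_d` exactly because `l > 5`. If `d ≤ l - 2`, no nonzero form of degree `d` vanishes on a star
configuration (`InGeneralPosition.eq_zero_of_vanishing`).

The dimension count is made effective by elimination
(`exists_homogeneous_vanishing_on_kernels`). The forms in question are the kernel vectors of the
evaluation matrices at the points of the configurations, whose entries are polynomials in the
coefficients of the lines. Where a given maximal minor of the matrix is nonzero, Cramer's rule
parametrizes the kernel vectors by polynomials in fewer variables than there are coefficients. These
polynomials are algebraically dependent, and a homogeneous component of a dependence relation is an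
equation satisfied by all these forms. The product of the equations over the finitely many choices
of a minor and of a normalization of the lines defines a hypersurface in `ℙ S_d`, off which no curve
contains a star configuration.
-/

namespace StarConfig

open MvPolynomial Matrix

/-! ### Elimination for families of kernels -/

section Elimination

variable {K : Type*} [Field K]

theorem eval_smul_of_isHomogeneous {E : Type*} {G : MvPolynomial E K} {n : ℕ}
    (hG : G.IsHomogeneous n) (t : K) (v : E → K) : eval (t • v) G = t ^ n * eval v G := by
  rw [eval_eq, eval_eq, Finset.mul_sum]
  refine Finset.sum_congr rfl fun m hm => ?_
  have hd : m.degree = n := by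
    rw [Finsupp.degree_eq_weight_one]
    exact hG (mem_support_iff.mp hm)
  simp only [Pi.smul_apply, smul_eq_mul, mul_pow, Finset.prod_mul_distrib,
    Finset.prod_pow_eq_pow_sum]
  rw [← hd, Finsupp.degree_apply]
  ring

/-- If `G` vanishes on the line spanned by `v`, so does each of its homogeneous components: their
values at `v` are the coefficients of the polynomial `t ↦ G (t v)`. -/
theorem eval_homogeneousComponent_eq_zero [Infinite K] {E : Type*} {G : MvPolynomial E K}
    {v : E → K} (h : ∀ t : K, eval (t • v) G = 0) (n : ℕ) :
    eval v (homogeneousComponent n G) = 0 := by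
  let q : Polynomial K := ∑ i ∈ Finset.range (G.totalDegree + 1),
    Polynomial.C (eval v (homogeneousComponent i G)) * Polynomial.X ^ i
  have hq : q = 0 := by
    refine Polynomial.funext fun t => ?_
    rw [Polynomial.eval_zero, ← h t]
    conv_rhs => rw [← sum_homogeneousComponent G, map_sum]
    simp only [q, Polynomial.eval_finsetSum]
    refine Finset.sum_congr rfl fun i _ => ?_
    rw [eval_smul_of_isHomogeneous (homogeneousComponent_isHomogeneous i G), mul_comm (t ^ i)]
    simp
  by_cases hn : n ≤ G.totalDegree
  · have := congrArg (fun p => Polynomial.coeff p n) hq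
    simpa [q, Polynomial.finsetSum_coeff, Polynomial.coeff_C_mul, Polynomial.coeff_X_pow,
      Nat.lt_succ_iff, hn] using this
  · rw [homogeneousComponent_eq_zero n G (not_le.1 hn), map_zero]

theorem exists_homogeneousComponent_ne_zero {E : Type*} {G : MvPolynomial E K} (hG : G ≠ 0) :
    ∃ n, homogeneousComponent n G ≠ 0 := by
  by_contra! h
  exact hG (by rw [← sum_homogeneousComponent G]; simp [h])

/-- More polynomials than variables are algebraically dependent: a polynomial map to an affine space
of larger dimension has its image in a hypersurface. -/
theorem exists_ne_zero_aeval_eq_zero {E σ : Type} [Finite E] [Finite σ]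
    (h : Nat.card σ < Nat.card E) (f : E → MvPolynomial σ K) :
    ∃ G : MvPolynomial E K, G ≠ 0 ∧ aeval f G = 0 := by
  by_contra! hf
  have hi : AlgebraicIndependent K f := by
    rw [algebraicIndependent_iff]
    intro p hp
    by_contra hp0
    exact hf p hp0 hp
  have := hi.lift_cardinalMk_le_trdeg
  rw [MvPolynomial.trdeg_of_isDomain] at this
  have := Cardinal.toNat_le_toNat this (by simp [Cardinal.mk_lt_aleph0])
  simp at this
  simp [Nat.card] at h
  omega

variable {P E : Type} [Fintype P] [DecidableEq P] [Fintype E]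

theorem exists_submatrix_det_ne_zero (N : Matrix P E K) (hN : Function.Surjective N.mulVec) :
    ∃ J : P → E, Function.Injective J ∧ (N.submatrix id J).det ≠ 0 := by
  obtain ⟨κ, a, ha, hs, hli⟩ := exists_linearIndependent' K N.col
  have htop : Submodule.span K (Set.range N.col) = ⊤ := by
    rw [← Matrix.range_mulVecLin, LinearMap.range_eq_top]
    exact hN
  rw [htop] at hs
  let b := Module.Basis.mk hli hs.ge
  have : Fintype κ := Fintype.ofInjective a ha
  let e : P ≃ κ := Fintype.equivOfCardEq (by
    rw [← Module.finrank_eq_card_basis b, Module.finrank_pi])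
  refine ⟨a ∘ e, ha.comp e.injective, ?_⟩
  rw [← isUnit_iff_ne_zero, ← Matrix.isUnit_iff_isUnit_det,
    ← Matrix.linearIndependent_cols_iff_isUnit]
  exact hli.comp e e.injective

open Classical in
/-- A parametrization, without denominators, of the kernels of the members of a family `M` of
matrices. The parameters are those of the family together with the entries, outside the columns
`J`, of a kernel vector; Cramer's rule then determines the entries in the columns `J`. The result is
multiplied by the minor of `M` on the columns `J`. -/
noncomputable def kernelParam {τ : Type} (M : Matrix P E (MvPolynomial τ K)) (J : P → E) :
    E → MvPolynomial (τ ⊕ {m // m ∉ Set.range J}) K :=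
  let M' := M.map (rename (R := K) (Sum.inl : τ → τ ⊕ {m // m ∉ Set.range J}))
  Function.extend J
    (fun p => -((M'.submatrix id J).adjugate *ᵥ
      fun p => ∑ m : {m // m ∉ Set.range J}, M' p m * X (Sum.inr m)) p)
    (fun m => if h : m ∉ Set.range J then (M'.submatrix id J).det * X (Sum.inr ⟨m, h⟩) else 0)

/-- The parametrization `kernelParam` reaches every kernel vector `v`, up to the factor given by the
minor. -/
theorem eval_kernelParam {τ : Type} (M : Matrix P E (MvPolynomial τ K)) {J : P → E}
    (hJ : Function.Injective J) (a : τ → K) (v : E → K) (hv : M.map (eval a) *ᵥ v = 0) (m : E) :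
    eval (Sum.elim a fun m => v m.1) (kernelParam M J m) =
      ((M.map (eval a)).submatrix id J).det * v m := by
  classical
  set φ := eval (R := K) (Sum.elim a fun m : {m // m ∉ Set.range J} => v m.1)
  have hφ (p : MvPolynomial τ K) : φ (rename Sum.inl p) = eval a p := by
    simp [φ, eval_rename, Function.comp_def]
  set N := M.map (eval a) with hN
  have hsub : (((M.map (rename (R := K) (Sum.inl : τ → τ ⊕ {m // m ∉ Set.range J}))).submatrix
      id J).map φ) = N.submatrix id J := by
    ext i j
    simp [hφ, N]
  by_cases hm : m ∈ Set.range J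
  · obtain ⟨p, rfl⟩ := hm
    -- The part of `M v = 0` outside the columns `J` is minus the part inside.
    have hw (i : P) : ∑ m : {m // m ∉ Set.range J}, N i m * v m =
        - ((N.submatrix id J) *ᵥ (v ∘ J)) i := by
      have h0 : ∑ m, N i m * v m = 0 := congrFun hv i
      rw [← Fintype.sum_subtype_add_sum_subtype (fun m => m ∈ Set.range J)] at h0
      rw [eq_neg_iff_add_eq_zero, add_comm, ← h0]
      congr 1
      convert! Fintype.sum_equiv (Equiv.ofInjective J hJ)
        (fun p => N i (J p) * v (J p)) (fun m => N i m.1 * v m.1) fun _ => rfl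
    rw [kernelParam, hJ.extend_apply, map_neg, RingHom.map_mulVec, ← RingHom.mapMatrix_apply,
      RingHom.map_adjugate, RingHom.mapMatrix_apply, hsub]
    have : (φ ∘ fun i => ∑ m : {m // m ∉ Set.range J},
        M.map (rename (R := K) (Sum.inl : τ → τ ⊕ {m // m ∉ Set.range J})) i m * X (Sum.inr m)) =
        -((N.submatrix id J) *ᵥ (v ∘ J)) := by
      funext i
      rw [Pi.neg_apply, ← hw i]
      simp [hφ, N, φ]
    rw [this, Matrix.mulVec_neg, Matrix.mulVec_mulVec, Matrix.adjugate_mul, Matrix.smul_mulVec,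
      Matrix.one_mulVec]
    simp
  · rw [kernelParam, Function.extend_apply' _ _ _ (by simpa using hm), dif_pos hm, map_mul,
      RingHom.map_det, RingHom.mapMatrix_apply, hsub]
    simp [φ]

/-- If a family of matrices depends on fewer parameters than the matrices have rows, the kernels of
its members of full row rank do not fill the space: they all lie in one hypersurface cone. For each
choice of columns with nonzero minor, the kernel is parametrized by `kernelParam` with too few
parameters; the hypersurfaces obtained are multiplied together. -/
theorem exists_homogeneous_vanishing_on_kernels [Infinite K] {τ : Type} [Finite τ]
    (h : Nat.card τ < Nat.card P) (M : Matrix P E (MvPolynomial τ K)) :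
    ∃ G : MvPolynomial E K, G ≠ 0 ∧ (∃ n, G.IsHomogeneous n) ∧
      ∀ (a : τ → K) (v : E → K), Function.Surjective (M.map (eval a)).mulVec →
        M.map (eval a) *ᵥ v = 0 → eval v G = 0 := by
  classical
  have key (J : {J : P → E // Function.Injective J}) : ∃ G : MvPolynomial E K, G ≠ 0 ∧
      (∃ n, G.IsHomogeneous n) ∧ ∀ (a : τ → K) (v : E → K),
        ((M.map (eval a)).submatrix id J.1).det ≠ 0 →
        M.map (eval a) *ᵥ v = 0 → eval v G = 0 := by
    obtain ⟨J, hJ⟩ := J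
    have hcard : Nat.card (τ ⊕ {m // m ∉ Set.range J}) < Nat.card E := by
      have h1 : Nat.card {m // m ∈ Set.range J} = Nat.card P :=
        Nat.card_congr (Equiv.ofInjective J hJ).symm
      have h2 := Nat.card_congr (Equiv.sumCompl (fun m => m ∈ Set.range J))
      rw [Nat.card_sum] at h2 ⊢
      omega
    obtain ⟨G, hG, hG0⟩ := exists_ne_zero_aeval_eq_zero hcard (kernelParam M J)
    obtain ⟨n, hn⟩ := exists_homogeneousComponent_ne_zero hG
    refine ⟨_, hn, ⟨n, homogeneousComponent_isHomogeneous n G⟩, fun a v hdet hv => ?_⟩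
    refine eval_homogeneousComponent_eq_zero (fun t => ?_) n
    -- Kernel vectors are rescaled to cancel the minor occurring in `kernelParam`.
    set D := ((M.map (eval a)).submatrix id J).det
    have ht : M.map (eval a) *ᵥ ((t / D) • v) = 0 := by rw [Matrix.mulVec_smul, hv, smul_zero]
    have h3 := congrArg (eval (Sum.elim a fun m => ((t / D) • v) m.1)) hG0
    rw [map_zero, map_aeval] at h3
    rw [← h3, eval]
    congr 2
    · ext; simp
    · funext m
      rw [eval_kernelParam M hJ a _ ht, Pi.smul_apply, Pi.smul_apply, smul_eq_mul, smul_eq_mul,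
        ← mul_assoc, mul_div_cancel₀ _ hdet]
  choose G hG hGh hGv using key
  choose n hn using hGh
  refine ⟨∏ J, G J, Finset.prod_ne_zero_iff.2 fun J _ => hG J,
    ⟨_, IsHomogeneous.prod _ _ _ fun J _ => hn J⟩, fun a v hs hv => ?_⟩
  obtain ⟨J, hJ, hdet⟩ := exists_submatrix_det_ne_zero _ hs
  rw [map_prod]
  exact Finset.prod_eq_zero (Finset.mem_univ ⟨J, hJ⟩) (hGv ⟨J, hJ⟩ a v hdet hv)

end Elimination

/-! ### Evaluation of forms at points -/

noncomputable instance (d : ℕ) : Fintype (Exponent d) :=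
  (Finsupp.finite_of_degree_eq (σ := Fin 3) d).fintype

theorem card_exponent (d : ℕ) : Nat.card (Exponent d) = (d + 2).choose 2 := by
  have h : Nat.card (Exponent d) =
      (Finset.finsuppAntidiag (Finset.univ : Finset (Fin 3)) d).card := by
    rw [← Nat.card_eq_finsetCard]
    exact Nat.card_congr (Equiv.subtypeEquivRight fun m => by
      simp [Finset.mem_finsuppAntidiag, Finsupp.degree_eq_sum])
  rw [h, Finset.card_finsuppAntidiag_nat_eq_choose, Finset.card_univ, Fintype.card_fin,
    ← Nat.choose_symm_add]
  congr 1
  omega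

/-- The matrix of the evaluation map that sends a form of degree `d`, given by its coefficients, to
its values at the vectors `x p`. It is defined over any commutative semiring, so that the vectors
can depend polynomially on parameters. -/
def evalMatrix {P R : Type*} [CommSemiring R] (d : ℕ) (x : P → Fin 3 → R) :
    Matrix P (Exponent d) R :=
  fun p m => ∏ c, x p c ^ m.1 c

theorem evalMatrix_map {P R S : Type*} [CommSemiring R] [CommSemiring S] (d : ℕ)
    (x : P → Fin 3 → R) (φ : R →+* S) :
    (evalMatrix d x).map φ = evalMatrix d fun p => φ ∘ x p := by
  ext p m
  simp [evalMatrix]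

theorem evalMatrix_mulVec_coords {P : Type*} {d : ℕ} (x : P → Fin 3 → ℂ) (F : Form d) (p : P) :
    (evalMatrix d x *ᵥ coords F) p = eval (x p) (F : MvPolynomial (Fin 3) ℂ) := by
  have hF : (F : MvPolynomial (Fin 3) ℂ).IsHomogeneous d := F.2
  rw [eval_eq', mulVec, dotProduct]
  have hs : (F : MvPolynomial (Fin 3) ℂ).support ⊆
      (Finset.univ : Finset (Exponent d)).map (Function.Embedding.subtype _) := by
    intro m hm
    have hd : m.degree = d := by
      rw [Finsupp.degree_eq_weight_one]
      exact hF (mem_support_iff.mp hm)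
    simpa using hd
  rw [Finset.sum_subset hs fun m _ hm => by rw [notMem_support_iff.1 hm, zero_mul],
    Finset.sum_map]
  exact Finset.sum_congr rfl fun m _ => mul_comm _ _

theorem coords_injective (d : ℕ) : Function.Injective (coords : Form d → Exponent d → ℂ) := by
  intro F G h
  refine Subtype.ext (MvPolynomial.ext _ _ fun m => ?_)
  by_cases hm : m.degree = d
  · exact congrFun h ⟨m, hm⟩
  · have hF : (F : MvPolynomial (Fin 3) ℂ).IsHomogeneous d := F.2
    have hG : (G : MvPolynomial (Fin 3) ℂ).IsHomogeneous d := G.2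
    rw [hF.coeff_eq_zero hm, hG.coeff_eq_zero hm]

theorem coords_surjective (d : ℕ) : Function.Surjective (coords : Form d → Exponent d → ℂ) := by
  intro v
  refine ⟨⟨∑ m, monomial m.1 (v m), ?_⟩, ?_⟩
  · exact Submodule.sum_mem _ fun m _ => isHomogeneous_monomial _ m.2
  · classical
    funext m
    simp [coords, coeff_sum, coeff_monomial, Subtype.val_inj]

/-! ### Forms vanishing at the intersection points of lines -/

/-- The pairs of distinct indices, each listed once: they index the points of a star configuration. -/
abbrev Pair (l : ℕ) : Type := {p : Fin l × Fin l // p.1 < p.2}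

theorem card_pair (l : ℕ) : Nat.card (Pair l) = l.choose 2 := by
  have h : Pair l ≃ Σ j : Fin l, {i : Fin l // i < j} :=
    { toFun := fun p => ⟨p.1.2, p.1.1, p.2⟩
      invFun := fun q => ⟨(q.2.1, q.1), q.2.2⟩
      left_inv := fun _ => rfl
      right_inv := fun _ => rfl }
  rw [Nat.card_congr h, Nat.card_sigma]
  simp only [Nat.card_eq_fintype_card]
  have (j : Fin l) : Fintype.card {i : Fin l // i < j} = j := by
    rw [Fintype.card_subtype, ← Fin.card_Iio j]
    congr 1
    ext; simp
  simp only [this]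
  rw [Fin.sum_univ_eq_sum_range (fun i => i), Finset.sum_range_id, Nat.choose_two_right]

/-- The intersection points of the lines with coefficient vectors `u i`, as cross products. -/
def crossPoints {R : Type*} [CommRing R] {l : ℕ} (u : Fin l → Fin 3 → R) (p : Pair l) :
    Fin 3 → R :=
  u p.1.1 ⨯₃ u p.1.2

theorem map_crossPoints {R S : Type*} [CommRing R] [CommRing S] {l : ℕ} (u : Fin l → Fin 3 → R)
    (φ : R →+* S) (p : Pair l) : φ ∘ crossPoints u p = crossPoints (fun i => φ ∘ u i) p := by
  funext c
  fin_cases c <;> simp [crossPoints, cross_apply]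

/-- The lines with coefficient vectors `u i` are distinct and no three of them are concurrent. -/
structure InGeneralPosition {l : ℕ} (u : Fin l → Fin 3 → ℂ) : Prop where
  cross_ne_zero : ∀ i j, i ≠ j → u i ⨯₃ u j ≠ 0
  triple_ne_zero : ∀ i j k, i ≠ j → i ≠ k → j ≠ k → u k ⬝ᵥ u i ⨯₃ u j ≠ 0

/-- The linear form with coefficient vector `w`. -/
noncomputable def linearForm (w : Fin 3 → ℂ) : MvPolynomial (Fin 3) ℂ := ∑ c, C (w c) * X c

theorem linearForm_isHomogeneous (w : Fin 3 → ℂ) : (linearForm w).IsHomogeneous 1 :=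
  IsHomogeneous.sum _ _ _ fun c _ => by
    simpa using (isHomogeneous_C _ (w c)).mul (isHomogeneous_X ℂ c)

theorem eval_linearForm (w x : Fin 3 → ℂ) : eval x (linearForm w) = w ⬝ᵥ x := by
  simp [linearForm, dotProduct]

/-- The product of all lines but two vanishes at every point of the star configuration except the
intersection point of these two. A power of a coordinate that is nonzero at that point brings the
degree from `l - 2` up to `d`. -/
theorem InGeneralPosition.exists_form {l d : ℕ} {u : Fin l → Fin 3 → ℂ} (hu : InGeneralPosition u)
    (hd : l ≤ d + 2) (p : Pair l) : ∃ F : Form d, ∀ q : Pair l,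
      eval (crossPoints u q) (F : MvPolynomial (Fin 3) ℂ) = 0 ↔ q ≠ p := by
  obtain ⟨⟨i, j⟩, hij : i < j⟩ := p
  obtain ⟨c, hc⟩ := Function.ne_iff.1 (hu.cross_ne_zero i j hij.ne)
  let T := (Finset.univ.erase i).erase j
  have hT : T.card = l - 2 := by
    rw [Finset.card_erase_of_mem (by simp [hij.ne']), Finset.card_erase_of_mem (by simp)]
    simp; omega
  have hl : 2 ≤ l := by have := j.2; have : i.1 < j.1 := hij; omega
  refine ⟨⟨(∏ k ∈ T, linearForm (u k)) * X c ^ (d - (l - 2)), ?_⟩, ?_⟩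
  · have h1 := (IsHomogeneous.prod T _ _ fun k _ => linearForm_isHomogeneous (u k)).mul
      ((isHomogeneous_X ℂ c).pow (d - (l - 2)))
    rw [Finset.sum_const, hT, smul_eq_mul, mul_one, one_mul, Nat.add_sub_cancel' (by omega)] at h1
    exact h1
  · rintro ⟨⟨i', j'⟩, hij' : i' < j'⟩
    simp only [crossPoints, map_mul, map_prod, map_pow, eval_X, eval_linearForm]
    constructor
    · rintro h0 heq
      obtain ⟨rfl, rfl⟩ : i' = i ∧ j' = j := by simpa using heq
      refine mul_ne_zero (Finset.prod_ne_zero_iff.2 fun k hk => ?_) (pow_ne_zero _ hc) h0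
      simp only [T, Finset.mem_erase] at hk
      exact hu.triple_ne_zero _ _ _ hij'.ne hk.2.1.symm hk.1.symm
    · intro hne
      have : i' ∈ T ∨ j' ∈ T := by
        by_contra! h
        simp only [T, Finset.mem_erase, Finset.mem_univ, and_true] at h
        apply hne
        simp only [Subtype.mk.injEq, Prod.mk.injEq]
        omega
      refine mul_eq_zero_of_left ?_ _
      rcases this with h | h
      · exact Finset.prod_eq_zero h (dot_self_cross _ _)
      · exact Finset.prod_eq_zero h (dot_cross_self _ _)

/-- A star configuration imposes independent conditions on forms of degree `d ≥ l - 2`. -/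
theorem InGeneralPosition.evalMatrix_surjective {l d : ℕ} {u : Fin l → Fin 3 → ℂ}
    (hu : InGeneralPosition u) (hd : l ≤ d + 2) :
    Function.Surjective (evalMatrix d (crossPoints u)).mulVec := by
  choose F hF using hu.exists_form hd
  intro w
  refine ⟨∑ p, (w p / eval (crossPoints u p) (F p).1) • coords (F p), ?_⟩
  funext q
  simp only [Matrix.mulVec_sum, Matrix.mulVec_smul, Finset.sum_apply, Pi.smul_apply,
    evalMatrix_mulVec_coords, smul_eq_mul]
  rw [Finset.sum_eq_single q]
  · exact div_mul_cancel₀ _ fun h => (hF q q).1 h rfl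
  · intro p _ hp
    rw [(hF p q).2 hp.symm, mul_zero]
  · simp

/-- No nonzero form of degree `d ≤ l - 2` vanishes on a star configuration. In degree `l - 2` the
evaluation map is surjective between spaces of the same dimension `l.choose 2`, hence injective;
smaller degrees reduce to this one through multiplication by a power of a coordinate. -/
theorem InGeneralPosition.eq_zero_of_vanishing {l d : ℕ} {u : Fin l → Fin 3 → ℂ}
    (hu : InGeneralPosition u) (hd : d + 2 ≤ l) (F : Form d)
    (hF : ∀ p : Pair l, eval (crossPoints u p) (F : MvPolynomial (Fin 3) ℂ) = 0) : F = 0 := by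
  obtain ⟨e, rfl⟩ := Nat.exists_eq_add_of_le hd
  have hs := hu.evalMatrix_surjective (d := d + e) (by omega)
  have hi : Function.Injective (evalMatrix (d + e) (crossPoints u)).mulVec := by
    have hcard : Module.finrank ℂ (Exponent (d + e) → ℂ) =
        Module.finrank ℂ (Pair (d + 2 + e) → ℂ) := by
      rw [Module.finrank_pi, Module.finrank_pi, ← Nat.card_eq_fintype_card,
        ← Nat.card_eq_fintype_card, card_exponent, card_pair]
      congr 1
      omega
    exact (LinearMap.injective_iff_surjective_of_finrank_eq_finrank
      (f := (evalMatrix (d + e) (crossPoints u)).mulVecLin) hcard).2 hs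
  let F' : Form (d + e) := ⟨F.1 * X 0 ^ e, by
    have := IsHomogeneous.mul (show F.1.IsHomogeneous d from F.2)
      ((isHomogeneous_X ℂ (0 : Fin 3)).pow e)
    rwa [one_mul] at this⟩
  have h0 : F' = 0 := by
    apply coords_injective
    apply hi
    funext p
    rw [evalMatrix_mulVec_coords, evalMatrix_mulVec_coords]
    simp [F', hF]
  have h1 : F.1 * X 0 ^ e = 0 := congrArg Subtype.val h0
  exact Subtype.ext ((mul_eq_zero.1 h1).resolve_right (pow_ne_zero _ (X_ne_zero _)))

/-! ### Curves containing a star configuration -/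

/-- A star configuration on a curve comes from coefficient vectors in general position that are
normalized to have one coordinate equal to `1`, so that each line has only two parameters. -/
theorem IsStarConfiguration.exists_normalized_lines {l d : ℕ} {X : Set Plane}
    (hX : IsStarConfiguration l X) {F : Form d} (hF : F ≠ 0)
    (hXF : X ⊆ curvePoints (Projectivization.mk ℂ F hF)) :
    ∃ (s : Fin l → Fin 3) (u : Fin l → Fin 3 → ℂ), (∀ i, u i (s i) = 1) ∧
      InGeneralPosition u ∧
      ∀ p : Pair l, eval (crossPoints u p) (F : MvPolynomial (Fin 3) ℂ) = 0 := by
  obtain ⟨ℓ, hinj, htriple, rfl⟩ := hX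
  have hrep (i : Fin l) : ∃ (c : Fin 3) (w : Fin 3 → ℂ) (hw : w ≠ 0), w c = 1 ∧
      ℓ i = Projectivization.mk ℂ w hw := by
    obtain ⟨c, hc⟩ := Function.ne_iff.1 (ℓ i).rep_nonzero
    rw [Pi.zero_apply] at hc
    have hw : ((ℓ i).rep c)⁻¹ • (ℓ i).rep ≠ 0 :=
      smul_ne_zero (inv_ne_zero hc) (ℓ i).rep_nonzero
    refine ⟨c, _, hw, by simp [hc], ?_⟩
    conv_lhs => rw [← (ℓ i).mk_rep]
    rw [Projectivization.mk_eq_mk_iff']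
    exact ⟨(ℓ i).rep c, by rw [smul_smul, mul_inv_cancel₀ hc, one_smul]⟩
  choose s u hu0 hu1 hu using hrep
  have hcross (i j : Fin l) (hij : i ≠ j) : u i ⨯₃ u j ≠ 0 := fun h => hij (hinj (by
    rw [hu i, hu j, Projectivization.mk_eq_mk_iff_crossProduct_eq_zero, h]))
  have hmem (i : Fin l) (v : Fin 3 → ℂ) (hv : v ≠ 0) :
      (Projectivization.mk ℂ v hv : Plane) ∈ linePoints (ℓ i) ↔ u i ⬝ᵥ v = 0 := by
    rw [linePoints, Set.mem_ofPred_eq, hu i, Projectivization.orthogonal_mk]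
  refine ⟨s, u, hu1, ⟨hcross, fun i j k hij hik hjk h => ?_⟩, fun p => ?_⟩
  · have hpt := hcross i j hij
    refine (Set.eq_empty_iff_forall_notMem.1 (htriple i j k hij hik hjk))
      (Projectivization.mk ℂ _ hpt) ⟨⟨?_, ?_⟩, ?_⟩
    · exact (hmem i _ hpt).2 (dot_self_cross _ _)
    · exact (hmem j _ hpt).2 (dot_cross_self _ _)
    · exact (hmem k _ hpt).2 h
  · have hpt := hcross p.1.1 p.1.2 p.2.ne
    rw [crossPoints, ← mk_mem_curvePoints_iff F hF _ hpt]
    exact hXF ⟨p.1.1, p.1.2, p.2, (hmem _ _ hpt).2 (dot_self_cross _ _),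
      (hmem _ _ hpt).2 (dot_cross_self _ _)⟩

/-- A property that fails only on a hypersurface of the space of forms is generic. -/
theorem genericCurve_of_homogeneous {d n : ℕ} {Q : PlaneCurve d → Prop}
    {G : MvPolynomial (Exponent d) ℂ} (hG : G ≠ 0) (hn : G.IsHomogeneous n)
    (h : ∀ (F : Form d) (hF : F ≠ 0), ¬ Q (Projectivization.mk ℂ F hF) → eval (coords F) G = 0) :
    GenericCurve d Q := by
  refine ⟨{C | eval (coords C.rep) G ≠ 0}, ⟨{G}, ?_, ?_⟩, ?_, ?_⟩
  · rintro _ rfl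
    exact ⟨n, hn⟩
  · ext C
    simp
  · let m₀ : Exponent d := ⟨Finsupp.single 0 d, by simp⟩
    -- The factor `X m₀` keeps the chosen vector away from `0` when `G` is a constant.
    obtain ⟨v, hv⟩ : ∃ v, eval v (G * X m₀) ≠ 0 := by
      by_contra! h0
      exact mul_ne_zero hG (X_ne_zero m₀) (MvPolynomial.funext fun v => by rw [h0 v, map_zero])
    rw [map_mul, eval_X] at hv
    obtain ⟨F, rfl⟩ := coords_surjective d v
    have hF : F ≠ 0 := by
      rintro rfl
      exact right_ne_zero_of_mul hv (by simp [coords])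
    refine ⟨Projectivization.mk ℂ F hF, ?_⟩
    rw [Set.mem_ofPred_eq, Ne, eval_coords_mk_rep_eq_zero_iff F hF hn]
    exact left_ne_zero_of_mul hv
  · intro C hC
    by_contra hQ
    exact hC (h C.rep C.rep_nonzero (by rwa [C.mk_rep]))

/-- The universal family of `l` lines whose `i`-th coefficient vector has a `1` at position `s i` and
independent variables at the two other positions. -/
noncomputable def chartLines {l : ℕ} (s : Fin l → Fin 3) (i : Fin l) :
    Fin 3 → MvPolynomial (Fin l × Fin 2) ℂ :=
  Fin.insertNth (α := fun _ => MvPolynomial (Fin l × Fin 2) ℂ) (s i) 1 fun k => X (i, k)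

/-- Every normalized family of lines is a specialization of the universal one. -/
theorem eval_comp_chartLines {l : ℕ} {s : Fin l → Fin 3} {u : Fin l → Fin 3 → ℂ}
    (hu : ∀ i, u i (s i) = 1) (i : Fin l) :
    eval (fun q : Fin l × Fin 2 => u q.1 ((s q.1).succAbove q.2)) ∘ chartLines s i = u i := by
  funext c
  refine Fin.succAboveCases (s i) ?_ (fun k => ?_) c
  · simp [chartLines, hu]
  · simp [chartLines]

end StarConfig

theorem theorem3p1 (l d : ℕ) (hl : 5 < l) :
    StarConfig.GenericCurve d (fun C : StarConfig.PlaneCurve d =>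
      ¬ ∃ X : Set StarConfig.Plane,
        StarConfig.IsStarConfiguration l X ∧ X ⊆ StarConfig.curvePoints C) := by
  open StarConfig MvPolynomial in
  rcases le_total (d + 2) l with hd | hd
  -- In degree at most `l - 2` no curve at all contains a star configuration.
  · refine genericCurve_of_homogeneous one_ne_zero (isHomogeneous_one _ ℂ) fun F hF hX => ?_
    obtain ⟨X, hX, hXF⟩ := not_not.1 hX
    obtain ⟨s, u, -, hu, hFu⟩ := hX.exists_normalized_lines hF hXF
    exact absurd (hu.eq_zero_of_vanishing hd F hFu) hF
  -- The parameter count: `2 l < l (l - 1) / 2` exactly because `5 < l`.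
  · have hcard : Nat.card (Fin l × Fin 2) < Nat.card (Pair l) := by
      rw [card_pair, Nat.card_prod, Nat.card_fin, Nat.card_fin, Nat.choose_two_right,
        Nat.lt_iff_add_one_le, Nat.le_div_iff_mul_le two_pos]
      have := Nat.mul_le_mul_left l (show 5 ≤ l - 1 by omega)
      linarith
    choose G hG0 hGh hG using fun s : Fin l → Fin 3 =>
      exists_homogeneous_vanishing_on_kernels hcard (evalMatrix d (crossPoints (chartLines s)))
    choose n hn using hGh
    refine genericCurve_of_homogeneous (Finset.prod_ne_zero_iff.2 fun s _ => hG0 s)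
      (IsHomogeneous.prod Finset.univ _ _ fun s _ => hn s) fun F hF hX => ?_
    obtain ⟨X, hX, hXF⟩ := not_not.1 hX
    obtain ⟨s, u, hus, hu, hFu⟩ := hX.exists_normalized_lines hF hXF
    have hM : (evalMatrix d (crossPoints (chartLines s))).map
        (eval fun q : Fin l × Fin 2 => u q.1 ((s q.1).succAbove q.2)) =
        evalMatrix d (crossPoints u) := by
      rw [evalMatrix_map]
      simp only [map_crossPoints, eval_comp_chartLines hus]
    rw [map_prod]
    refine Finset.prod_eq_zero (Finset.mem_univ s)
      (hG s (fun q => u q.1 ((s q.1).succAbove q.2)) _ ?_ ?_)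
    · rw [hM]
      exact hu.evalMatrix_surjective hd
    · rw [hM]
      funext p
      rw [evalMatrix_mulVec_coords, hFu p, Pi.zero_apply]
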